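/- Let $X$ be an infinite-dimensional real Banach space with closed unit ball $B_X$, unit sphere $S_X$ and dual $X^*$. Suppose that at least one of the following conditions holds. 1. $X$ is uniformly Fréchet smooth, i.e. the norm is Fréchet differentiable at every point of $S_X$ and the limit defining the derivative at $x$ is uniform in $x\in S_X$. 2. There is $\varepsilon>0$ such that the $\varepsilon$-cone-smooth points of $B_X$ are dense in $S_X$. Here $x\in S_X$ is $\varepsilon$-cone-smooth if there is $f\in X^*$ with $\|f\|=1$ such that every $v\in X$ with $f(v)\ge\frac17\|v\|$ and $\|v\|\le\varepsilon$ satisfies $x-v\in B_X$. 3. $\mathcal K(X)<2$, where $\mathcal K(X)=\sup_A\inf\{\|a-b\|: a,b\in A,\ a\ne b\}$, the supremum being over all countably infinite $A\subset S_X$, is the Kottman constant of $X$. 4. For each $x\in S_X$ at least one of the following holds (which one may depend on $x$): - $x$ is an LUR point: whenever $y_n\in S_X$ and $\|x+y_n\|\to2$, then $y_n\to x$; - $x$ is an LND2 point: there is $\delta>0$ with $\operatorname{diam}\{y\in S_X:\|\frac{x+y}2\|\ge1-\delta\}<2$; - the norm is Fréchet differentiable at $x$, and $x$ is a strongly exposed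 point of $B_X$, i.e. there is $f\in X^*$ with $\|f\|=f(x)=1$ such that $y_n\to x$ whenever $y_n\in B_X$ and $f(y_n)\to f(x)$; - the norm is Fréchet differentiable at $x$, and the unique $f_x\in X^*$ with $\|f_x\|=f_x(x)=1$ determines a slice $\{y\in B_X: f_x(y)>1-\alpha\}$, for some $\alpha>0$, of diameter $<2$. Then $X$ admits no star-finite covering by closed balls of positive radius, that is, there is no family of closed balls of positive radius with union $X$ in which each member intersects only finitely many other members. In particular, an infinite-dimensional Banach space that is LUR (every point of $S_X$ is an LUR point) or uniformly Fréchet smooth admits no star-finite covering by closed balls of positive radius. -/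

import Mathlib

open Metric Set Filter Topology

namespace BallCoverings

/-! ### Families of sets -/

section Families

variable {X : Type*}

/-- A family of sets is star-finite if each of its members intersects only finitely many other
members of the family. -/
def StarFinite (𝓕 : Set (Set X)) : Prop :=
  ∀ F ∈ 𝓕, {G ∈ 𝓕 | G ≠ F ∧ (F ∩ G).Nonempty}.Finite

/-- A family of sets covers the whole space. -/
def IsCovering (𝓕 : Set (Set X)) : Prop :=
  ⋃₀ 𝓕 = univ

/-- Every member of the family is a closed ball of positive radius. -/
def ConsistsOfClosedBalls [PseudoMetricSpace X] (𝓕 : Set (Set X)) : Prop :=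
  ∀ F ∈ 𝓕, ∃ (c : X) (r : ℝ), 0 < r ∧ F = closedBall c r

end Families

/-- `X` admits a star-finite covering by closed balls. -/
def AdmitsStarFiniteBallCovering (X : Type*) [PseudoMetricSpace X] : Prop :=
  ∃ 𝓑 : Set (Set X), ConsistsOfClosedBalls 𝓑 ∧ IsCovering 𝓑 ∧ StarFinite 𝓑

/-! ### Points of the unit sphere

The predicates of this section are meant for points `x` with `‖x‖ = 1`. -/

section Points

variable {X : Type*} [NormedAddCommGroup X] [NormedSpace ℝ X]

/-- `x` is an LUR (locally uniformly rotund) point of the unit ball. -/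
def IsLURPoint (x : X) : Prop :=
  ∀ y : ℕ → X, (∀ n, ‖y n‖ = 1) →
    Tendsto (fun n => ‖x + y n‖) atTop (𝓝 2) → Tendsto y atTop (𝓝 x)

/-- `x` is an LND2 (locally non-D2) point of the unit ball. The set whose diameter is taken is
contained in the unit sphere, hence bounded. -/
def IsLND2Point (x : X) : Prop :=
  ∃ δ : ℝ, 0 < δ ∧
    diam {y : X | y ∈ sphere (0 : X) 1 ∧ 1 - δ ≤ ‖(2⁻¹ : ℝ) • (x + y)‖} < 2

/-- `x` is a Fréchet smooth point: the norm is Fréchet differentiable at `x`. -/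
def IsFrechetSmoothPoint (x : X) : Prop :=
  DifferentiableAt ℝ (fun z : X => ‖z‖) x

/-- `f` is a norm-one functional that supports the closed unit ball at `x`, that is, its supremum
`‖f‖ = 1` over the unit ball is attained at `x`. -/
def SupportsUnitBallAt (f : StrongDual ℝ X) (x : X) : Prop :=
  ‖f‖ = 1 ∧ f x = 1

/-- `x` is a strongly exposed point of the closed unit ball. -/
def IsStronglyExposedPoint (x : X) : Prop :=
  ∃ f : StrongDual ℝ X, SupportsUnitBallAt f x ∧
    ∀ y : ℕ → X, (∀ n, y n ∈ closedBall (0 : X) 1) →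
      Tendsto (fun n => f (y n)) atTop (𝓝 (f x)) → Tendsto y atTop (𝓝 x)

/-- The slice of the closed unit ball determined by the norm-one functional `f` and `α`. -/
def slice (f : StrongDual ℝ X) (α : ℝ) : Set X :=
  {y | y ∈ closedBall (0 : X) 1 ∧ 1 - α < f y}

/-- There is exactly one norm-one functional supporting the unit ball at `x`, and it determines a
slice of the unit ball of diameter less than `2`. -/
def HasSmallSupportingSlice (x : X) : Prop :=
  ∃ f : StrongDual ℝ X, SupportsUnitBallAt f x ∧
    (∀ g : StrongDual ℝ X, SupportsUnitBallAt g x → g = f) ∧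
    ∃ α : ℝ, 0 < α ∧ diam (slice f α) < 2

/-- The closed convex cone `C(α, f)`. -/
def cone (α : ℝ) (f : StrongDual ℝ X) : Set X :=
  {v | α * ‖v‖ ≤ f v}

/-- `x` is an `ε`-cone-smooth point of the closed unit ball:
`[x - C(1/7, f)] ∩ [x + ε B_X] ⊆ B_X` for some norm-one functional `f`. -/
def IsConeSmoothPoint (ε : ℝ) (x : X) : Prop :=
  ∃ f : StrongDual ℝ X, ‖f‖ = 1 ∧
    (fun v => x - v) '' cone (1 / 7) f ∩ closedBall x ε ⊆ closedBall (0 : X) 1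

end Points

/-! ### Properties of the space -/

section Spaces

variable (X : Type*) [NormedAddCommGroup X] [NormedSpace ℝ X]

/-- The norm is LUR (locally uniformly rotund). -/
def IsLURSpace : Prop :=
  ∀ x : X, ‖x‖ = 1 → IsLURPoint x

/-- The norm is uniformly Fréchet smooth: it is Fréchet differentiable on the unit sphere, and the
limit defining the derivative at `x` is uniform for `x` in the unit sphere. -/
def IsUniformlyFrechetSmooth : Prop :=
  (∀ x : X, ‖x‖ = 1 → IsFrechetSmoothPoint x) ∧
  ∀ ε : ℝ, 0 < ε → ∃ δ : ℝ, 0 < δ ∧ ∀ x : X, ‖x‖ = 1 → ∀ h : X, ‖h‖ ≤ δ →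
    |‖x + h‖ - ‖x‖ - fderiv ℝ (fun z : X => ‖z‖) x h| ≤ ε * ‖h‖

/-- For some `ε > 0`, the `ε`-cone-smooth points of the unit ball are dense in the unit sphere. -/
def HasDenseConeSmoothPoints : Prop :=
  ∃ ε : ℝ, 0 < ε ∧
    sphere (0 : X) 1 ⊆ closure {x : X | x ∈ sphere (0 : X) 1 ∧ IsConeSmoothPoint ε x}

/-- The Kottman constant: the supremum of the separations `inf {‖a - b‖ : a, b ∈ A, a ≠ b}` of the
countably infinite subsets `A` of the unit sphere. All these separations are at most `2`, and such
sets `A` exist when `X` is infinite-dimensional. -/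
noncomputable def kottmanConstant : ℝ :=
  sSup {s : ℝ | ∃ A : Set X, A ⊆ sphere (0 : X) 1 ∧ A.Infinite ∧ A.Countable ∧ s = A.infsep}

end Spaces

end BallCoverings

/-! Take a star-finite covering by closed balls and pass to a minimal subcovering.

If, for each ρ > 0, the balls of radius at least ρ are locally finite, Baire's theorem gives a
contradiction (`not_isCovering_of_locallyFinite`). In infinite dimension the finitely many
neighbours of a ball cannot cover its sphere without covering the ball, so by minimality each ball
has a boundary point in no other ball, and that point is singular. By Baire, near some singular z
all singular points lie in finitely many large balls. But infinitely many small balls come close to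
z, each contains a singular point, and so each meets one of those large balls, against
star-finiteness.

If local finiteness fails, large balls accumulate at a boundary point z of a ball C. Thinned, shrunk
to a common radius and rescaled (`exists_touching_sequence`, `exists_almost_two_separated`), they
give unit vectors w n with ‖w n - w m‖ ≥ 2 - o(1) and ‖x + t • w n‖ ≥ 1 + t - o(1), where x points
from z to the centre of C. Conditions 3 and 4 forbid such a sequence. Conditions 1 and 2 make two of
any three such balls overlap, by `exists_common_large_value`. -/

namespace BallCoverings

/-! ### Balls touching a point, and finite convex covers of spheres. -/

section Geometry

variable {X : Type*} [NormedAddCommGroup X] [NormedSpace ℝ X]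

/-- A closed ball contains smaller closed balls that touch it at the boundary point nearest to a
given exterior point. -/
lemma exists_closedBall_subset_of_le_norm {c z : X} {r : ℝ} (hr : 0 < r) (hz : r ≤ ‖c - z‖) :
    ∃ p u : X, ‖u‖ = 1 ∧ ‖p - z‖ = ‖c - z‖ - r ∧
      ∀ s, 0 ≤ s → s ≤ r → closedBall (p + s • u) s ⊆ closedBall c r := by
  have hpos : 0 < ‖c - z‖ := hr.trans_le hz
  set u : X := ‖c - z‖⁻¹ • (c - z) with hu
  have hu1 : ‖u‖ = 1 := by rw [hu, norm_smul, norm_inv, norm_norm, inv_mul_cancel₀ hpos.ne']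
  have hcz : c - z = ‖c - z‖ • u := by rw [hu, smul_smul, mul_inv_cancel₀ hpos.ne', one_smul]
  refine ⟨c - r • u, u, hu1, ?_, fun s hs hsr => closedBall_subset_closedBall' ?_⟩
  · have : c - r • u - z = (‖c - z‖ - r) • u := by rw [sub_smul, ← hcz]; abel
    rw [this, norm_smul, hu1, mul_one, Real.norm_of_nonneg (sub_nonneg.2 hz)]
  · have : c - r • u + s • u - c = -((r - s) • u) := by rw [sub_smul]; abel
    rw [dist_eq_norm, this, norm_neg, norm_smul, hu1, mul_one,
      Real.norm_of_nonneg (sub_nonneg.2 hsr)]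
    linarith

/-- In an infinite-dimensional space, finitely many closed convex sets that cover a sphere also
cover the ball it bounds. -/
lemma closedBall_subset_sUnion_of_sphere_subset (hX : ¬ FiniteDimensional ℝ X) {𝓖 : Set (Set X)}
    (hfin : 𝓖.Finite) (hconv : ∀ G ∈ 𝓖, Convex ℝ G) (hclosed : ∀ G ∈ 𝓖, IsClosed G)
    {c : X} {r : ℝ} (hcov : sphere c r ⊆ ⋃₀ 𝓖) : closedBall c r ⊆ ⋃₀ 𝓖 := by
  intro b hb
  by_contra hbG
  have hsep : ∀ G : 𝓖, ∃ f : StrongDual ℝ X, ∀ y ∈ (G : Set X), f b < f y := by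
    intro G
    obtain ⟨f, u, hfb, hf⟩ := geometric_hahn_banach_point_closed (hconv G G.2) (hclosed G G.2)
      (fun h => hbG ⟨G, G.2, h⟩)
    exact ⟨f, fun y hy => hfb.trans (hf y hy)⟩
  choose f hf using hsep
  have : Finite 𝓖 := hfin
  -- Finitely many functionals have a common kernel vector v. The line b + t • v misses every G, yet
  -- must cross the sphere.
  have hker : ∃ v : X, v ≠ 0 ∧ ∀ G, f G v = 0 := by
    by_contra! hcon
    refine hX (FiniteDimensional.of_injective
      (LinearMap.pi fun G : 𝓖 => (f G : X →ₗ[ℝ] ℝ)) ?_)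
    rw [← LinearMap.ker_eq_bot, LinearMap.ker_eq_bot']
    intro v hv
    by_contra hv0
    obtain ⟨G, hG⟩ := hcon v hv0
    exact hG (congrFun hv G)
  obtain ⟨v, hv0, hv⟩ := hker
  have hcont : Continuous fun t : ℝ => ‖b + t • v - c‖ := by fun_prop
  have hvpos : 0 < ‖v‖ := norm_pos_iff.2 hv0
  have hb' : ‖b - c‖ ≤ r := by simpa [dist_eq_norm] using hb
  have hr : 0 ≤ r := (norm_nonneg _).trans hb'
  set T : ℝ := 2 * r / ‖v‖ with hT
  have hTpos : 0 ≤ T := by positivity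
  have hlarge : r ≤ ‖b + T • v - c‖ := by
    have h1 : ‖T • v‖ = 2 * r := by
      rw [norm_smul, Real.norm_of_nonneg hTpos, hT, div_mul_cancel₀ _ hvpos.ne']
    have h2 : ‖T • v‖ ≤ ‖b + T • v - c‖ + ‖b - c‖ := by
      have : T • v = (b + T • v - c) - (b - c) := by abel
      calc ‖T • v‖ = ‖(b + T • v - c) - (b - c)‖ := by rw [← this]
        _ ≤ _ := norm_sub_le _ _
    linarith
  obtain ⟨t, -, ht⟩ := intermediate_value_Icc hTpos hcont.continuousOn
    (show r ∈ Icc _ _ from ⟨by simpa using hb', hlarge⟩)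
  obtain ⟨G, hG, hbt⟩ := hcov (show b + t • v ∈ sphere c r by simpa [dist_eq_norm] using ht)
  have := hf ⟨G, hG⟩ _ hbt
  simp [hv] at this

end Geometry

/-! ### Minimal subcoverings. -/

section Subcoverings

variable {X : Type*}

lemma StarFinite.mono {𝓑 𝓒 : Set (Set X)} (h : StarFinite 𝓑) (hsub : 𝓒 ⊆ 𝓑) : StarFinite 𝓒 :=
  fun F hF => (h F (hsub hF)).subset fun _ hG => ⟨hsub hG.1, hG.2⟩

lemma StarFinite.finite_inter_nonempty {𝓑 : Set (Set X)} (h : StarFinite 𝓑) {F : Set X}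
    (hF : F ∈ 𝓑) : {G ∈ 𝓑 | (F ∩ G).Nonempty}.Finite :=
  ((h F hF).insert F).subset fun G hG => by
    by_cases hGF : G = F
    · exact Or.inl hGF
    · exact Or.inr ⟨hG.1, hGF, hG.2⟩

/-- A star-finite covering contains a minimal covering. -/
lemma StarFinite.exists_minimal_subcovering {𝓑 : Set (Set X)} (h : StarFinite 𝓑)
    (hcov : IsCovering 𝓑) :
    ∃ 𝓒 ⊆ 𝓑, IsCovering 𝓒 ∧ ∀ B ∈ 𝓒, ¬ B ⊆ ⋃₀ (𝓒 \ {B}) := by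
  obtain ⟨𝓒, hCB, hmin⟩ := zorn_superset_nonempty {𝓒 : Set (Set X) | 𝓒 ⊆ 𝓑 ∧ IsCovering 𝓒} (by
    intro K hK hchain ⟨𝓚, h𝓚⟩
    refine ⟨⋂₀ K, ⟨(sInter_subset_of_mem h𝓚).trans (hK h𝓚).1, ?_⟩,
      fun s hs => sInter_subset_of_mem hs⟩
    refine eq_univ_of_forall fun x => ?_
    by_contra hx
    have hx' : ∀ B ∈ 𝓑, x ∈ B → ∃ 𝓛 ∈ K, B ∉ 𝓛 := by
      intro B hB hxB
      by_contra! hcon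
      exact hx ⟨B, fun 𝓛 h𝓛 => hcon 𝓛 h𝓛, hxB⟩
    have hfin : {B ∈ 𝓑 | x ∈ B}.Finite := by
      obtain ⟨B, hB, hxB⟩ := hcov.symm.subset (mem_univ x)
      exact (h.finite_inter_nonempty hB).subset fun G hG => ⟨hG.1, x, hxB, hG.2⟩
    -- Only finitely many members contain x, so one element of the chain omits them all and fails to
    -- cover x.
    have hall : ∃ 𝓛 ∈ K, ∀ B ∈ {B ∈ 𝓑 | x ∈ B}, B ∉ 𝓛 := by
      refine hfin.induction_on_subset (motive := fun s _ => ∃ 𝓛 ∈ K, ∀ B ∈ s, B ∉ 𝓛) _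
        ⟨𝓚, h𝓚, by simp⟩ ?_
      rintro B s hB - - ⟨𝓛, h𝓛, hL⟩
      obtain ⟨𝓜, h𝓜, hM⟩ := hx' B hB.1 hB.2
      rcases hchain.total h𝓛 h𝓜 with hle | hle
      · refine ⟨𝓛, h𝓛, ?_⟩
        rintro A (rfl | hA)
        exacts [fun hA => hM (hle hA), hL A hA]
      · refine ⟨𝓜, h𝓜, ?_⟩
        rintro A (rfl | hA)
        exacts [hM, fun hA' => hL A hA (hle hA')]
    obtain ⟨𝓛, h𝓛, hL⟩ := hall
    obtain ⟨B, hB, hxB⟩ := (hK h𝓛).2.symm.subset (mem_univ x)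
    exact hL B ⟨(hK h𝓛).1 hB, hxB⟩ hB) 𝓑 ⟨Subset.rfl, hcov⟩
  refine ⟨𝓒, hCB, hmin.prop.2, fun B hB hBsub => ?_⟩
  have hcov' : IsCovering (𝓒 \ {B}) := by
    refine eq_univ_of_forall fun x => ?_
    obtain ⟨A, hA, hxA⟩ := hmin.prop.2.symm.subset (mem_univ x)
    by_cases hAB : A = B
    · exact hBsub (hAB ▸ hxA)
    · exact ⟨A, ⟨hA, hAB⟩, hxA⟩
  exact (hmin.le_of_le ⟨sdiff_subset.trans hCB, hcov'⟩ sdiff_subset hB).2 rfl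

end Subcoverings

/-! ### Singular points and the Baire category argument. -/

section Singular

variable {X : Type*}

/-- The members of a family that are closed balls of radius at least `ρ`. -/
def ballsOfRadiusGE [PseudoMetricSpace X] (𝓑 : Set (Set X)) (ρ : ℝ) : Set (Set X) :=
  {B ∈ 𝓑 | ∃ c r, ρ ≤ r ∧ B = closedBall c r}

/-- A point is singular for a family if each of its neighbourhoods meets infinitely many members. -/
def singularPoints [TopologicalSpace X] (𝓑 : Set (Set X)) : Set X :=
  {z | ∀ U ∈ 𝓝 z, {B ∈ 𝓑 | (B ∩ U).Nonempty}.Infinite}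

lemma isClosed_singularPoints [TopologicalSpace X] (𝓑 : Set (Set X)) :
    IsClosed (singularPoints 𝓑) := by
  rw [← isOpen_compl_iff, isOpen_iff_mem_nhds]
  intro z hz
  simp only [singularPoints, mem_compl_iff, mem_ofPred_eq, not_forall, not_infinite] at hz
  obtain ⟨U, hU, hfin⟩ := hz
  filter_upwards [eventually_mem_nhds_iff.2 hU] with y hy hys
  exact hys U hy hfin

variable [NormedAddCommGroup X] [NormedSpace ℝ X]

/-- Each member of a minimal star-finite covering by closed balls contains a singular point. -/
lemma exists_mem_singularPoints (hX : ¬ FiniteDimensional ℝ X) {𝓑 : Set (Set X)}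
    (hball : ConsistsOfClosedBalls 𝓑) (hcov : IsCovering 𝓑) (hstar : StarFinite 𝓑)
    (hmin : ∀ B ∈ 𝓑, ¬ B ⊆ ⋃₀ (𝓑 \ {B})) {B : Set X} (hB : B ∈ 𝓑) :
    (B ∩ singularPoints 𝓑).Nonempty := by
  obtain ⟨c, r, hr, hBeq⟩ := hball B hB
  have hclosed : ∀ A ∈ 𝓑, IsClosed A := by
    intro A hA
    obtain ⟨c, r, -, rfl⟩ := hball A hA
    exact isClosed_closedBall
  have hz : ∃ z ∈ sphere c r, ∀ A ∈ 𝓑, A ≠ B → z ∉ A := by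
    by_contra! hcon
    refine hmin B hB ?_
    have hsub : closedBall c r ⊆ ⋃₀ {G ∈ 𝓑 | G ≠ B ∧ (B ∩ G).Nonempty} := by
      refine closedBall_subset_sUnion_of_sphere_subset hX (hstar B hB) ?_
        (fun G hG => hclosed G hG.1) ?_
      · rintro G ⟨hG, -⟩
        obtain ⟨c, r, -, rfl⟩ := hball G hG
        exact convex_closedBall c r
      · intro z hz
        obtain ⟨A, hA, hAB, hzA⟩ := hcon z hz
        exact ⟨A, ⟨hA, hAB, z, hBeq ▸ sphere_subset_closedBall hz, hzA⟩, hzA⟩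
    rw [← hBeq] at hsub
    exact hsub.trans (sUnion_subset_sUnion fun G hG => ⟨hG.1, hG.2.1⟩)
  obtain ⟨z, hzs, hz⟩ := hz
  refine ⟨z, hBeq ▸ sphere_subset_closedBall hzs, fun U hU hfin => ?_⟩
  have hV : U \ ⋃₀ ({A ∈ 𝓑 | (A ∩ U).Nonempty} \ {B}) ∈ 𝓝 z := by
    refine inter_mem hU (IsClosed.compl_mem_nhds ?_ ?_)
    · rw [sUnion_eq_biUnion]
      exact (hfin.subset sdiff_subset).isClosed_biUnion fun A hA => hclosed A hA.1.1
    · rintro ⟨A, ⟨hA, hAB⟩, hzA⟩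
      exact hz A hA.1 hAB hzA
  -- Near z only B is left to cover, so z would be interior to B although it lies on the bounding
  -- sphere.
  have hBz : B ∈ 𝓝 z := by
    filter_upwards [hV] with y hy
    obtain ⟨A, hA, hyA⟩ := hcov.symm.subset (mem_univ y)
    by_contra hyB
    exact hy.2 ⟨A, ⟨⟨hA, y, hyA, hy.1⟩, fun h => hyB (h ▸ hyA)⟩, hyA⟩
  rw [hBeq, ← mem_interior_iff_mem_nhds, interior_closedBall c hr.ne'] at hBz
  exact (mem_ball.1 hBz).ne (mem_sphere.1 hzs)

/-- There is no star-finite covering by closed balls whose members of radius at least `ρ` form a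
locally finite family for each `ρ > 0`. -/
lemma not_isCovering_of_locallyFinite [CompleteSpace X] (hX : ¬ FiniteDimensional ℝ X)
    {𝓑 : Set (Set X)} (hball : ConsistsOfClosedBalls 𝓑) (hstar : StarFinite 𝓑)
    (hmin : ∀ B ∈ 𝓑, ¬ B ⊆ ⋃₀ (𝓑 \ {B}))
    (hloc : ∀ ρ : ℝ, 0 < ρ → LocallyFinite fun B : ballsOfRadiusGE 𝓑 ρ => (B : Set X)) :
    ¬ IsCovering 𝓑 := by
  intro hcov
  have hsing : ∀ B ∈ 𝓑, (B ∩ singularPoints 𝓑).Nonempty := fun B hB =>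
    exists_mem_singularPoints hX hball hcov hstar hmin hB
  have hfin : ∀ ρ : ℝ, 0 < ρ → ∀ z : X, ∃ δ > 0,
      {B ∈ ballsOfRadiusGE 𝓑 ρ | (B ∩ ball z δ).Nonempty}.Finite := by
    intro ρ hρ z
    obtain ⟨U, hU, hUfin⟩ := hloc ρ hρ z
    obtain ⟨δ, hδ, hsub⟩ := Metric.mem_nhds_iff.1 hU
    refine ⟨δ, hδ, (hUfin.image Subtype.val).subset ?_⟩
    rintro B ⟨hB, hne⟩
    exact ⟨⟨B, hB⟩, hne.mono (inter_subset_inter_right _ hsub), rfl⟩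
  have hS : Nonempty (singularPoints 𝓑) := by
    obtain ⟨B, hB, -⟩ := hcov.symm.subset (mem_univ (0 : X))
    obtain ⟨z, -, hz⟩ := hsing B hB
    exact ⟨⟨z, hz⟩⟩
  have hcomp : CompleteSpace (singularPoints 𝓑) :=
    (isClosed_singularPoints 𝓑).completeSpace_coe
  obtain ⟨k, z, hz⟩ := nonempty_interior_of_iUnion_of_closed
    (f := fun k : ℕ => ((↑) : singularPoints 𝓑 → X) ⁻¹'
      (⋃ B : ballsOfRadiusGE 𝓑 (1 / ((k : ℝ) + 1)), (B : Set X)))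
    (fun k => IsClosed.preimage continuous_subtype_val
      ((hloc _ Nat.one_div_pos_of_nat).isClosed_iUnion (by
        rintro ⟨B, -, c, r, -, rfl⟩
        exact isClosed_closedBall)))
    (by
      refine eq_univ_of_forall fun z => ?_
      obtain ⟨B, hB, hzB⟩ := hcov.symm.subset (mem_univ (z : X))
      obtain ⟨c, r, hr, hBeq⟩ := hball B hB
      obtain ⟨k, hk⟩ := exists_nat_one_div_lt hr
      exact mem_iUnion.2 ⟨k, mem_iUnion.2 ⟨⟨B, hB, c, r, hk.le, hBeq⟩, hzB⟩⟩)
  rw [mem_interior_iff_mem_nhds, Metric.mem_nhds_iff] at hz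
  obtain ⟨δ₁, hδ₁, hz⟩ := hz
  obtain ⟨δ₂, hδ₂, hfin₂⟩ := hfin _ (Nat.one_div_pos_of_nat (α := ℝ) (n := k)) z
  set δ := min δ₁ δ₂ with hδ
  have hδpos : 0 < δ := lt_min hδ₁ hδ₂
  -- A ball of radius below δ / 4 with a point within δ / 4 of z lies within 3δ / 4 of z, so its
  -- singular point is in the Baire neighbourhood.
  obtain ⟨δ₃, hδ₃, hfin₃⟩ := hfin (δ / 4) (by positivity) z
  set 𝓗 := {B ∈ ballsOfRadiusGE 𝓑 (1 / ((k : ℝ) + 1)) | (B ∩ ball (z : X) δ₂).Nonempty}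
  have hbad : (⋃ H ∈ 𝓗, {G ∈ 𝓑 | (H ∩ G).Nonempty}).Finite :=
    hfin₂.biUnion fun H hH => hstar.finite_inter_nonempty hH.1.1
  obtain ⟨B, ⟨hB, y, hyB, hy⟩, hBbad⟩ := ((z.2 (ball z (min δ₃ (δ / 4)))
    (ball_mem_nhds _ (by positivity))).sdiff (hbad.union hfin₃)).nonempty
  obtain ⟨c, r, hr, hBeq⟩ := hball B hB
  have hyz : dist y z < min δ₃ (δ / 4) := hy
  have hr' : r < δ / 4 := by
    by_contra! hcon
    exact hBbad (Or.inr ⟨⟨hB, c, r, hcon, hBeq⟩, y, hyB, hyz.trans_le (min_le_left _ _)⟩)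
  obtain ⟨w, hwB, hw⟩ := hsing B hB
  have hwz : dist w z < δ := by
    have h1 : dist w c ≤ r := by rw [hBeq] at hwB; exact hwB
    have h2 : dist y c ≤ r := by rw [hBeq] at hyB; exact hyB
    have h3 : dist w z ≤ dist w c + dist y c + dist y z := by
      rw [dist_comm y c]
      exact dist_triangle4 w c y z
    have h4 := hyz.trans_le (min_le_right _ _)
    linarith
  obtain ⟨H, hwH⟩ := mem_iUnion.1 (hz (show (⟨w, hw⟩ : singularPoints 𝓑) ∈ ball z δ₁ from
    hwz.trans_le (min_le_left _ _)))
  exact hBbad (Or.inl (mem_biUnion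
    (show (H : Set X) ∈ 𝓗 from ⟨H.2, w, hwH, hwz.trans_le (min_le_right _ _)⟩)
    ⟨hB, w, hwH, hwB⟩))

end Singular

/-! ### Balls accumulating at a point, and their rescaled directions. -/

section Touching

variable {X : Type*} [NormedAddCommGroup X] [NormedSpace ℝ X]

/-- If the members of radius at least `ρ` of a star-finite covering by closed balls are not locally
finite, then there are a point `z`, a ball touching `z`, and pairwise disjoint balls, disjoint from
the first one, that touch points `p n` converging to `z`. All these balls can be shrunk, keeping the
touching points. -/
lemma exists_touching_sequence {𝓑 : Set (Set X)} (hball : ConsistsOfClosedBalls 𝓑)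
    (hcov : IsCovering 𝓑) (hstar : StarFinite 𝓑) {ρ : ℝ} (hρ : 0 < ρ)
    (hnot : ¬ LocallyFinite fun B : ballsOfRadiusGE 𝓑 ρ => (B : Set X)) :
    ∃ (σ : ℝ) (z x : X) (p u : ℕ → X), 0 < σ ∧ Tendsto p atTop (𝓝 z) ∧ ‖x‖ = 1 ∧
      (∀ n, ‖u n‖ = 1) ∧
      (∀ n m, n ≠ m → Disjoint (closedBall (p n + σ • u n) σ) (closedBall (p m + σ • u m) σ)) ∧
      ∀ n s, 0 ≤ s → s ≤ σ →
        Disjoint (closedBall (z + σ • x) σ) (closedBall (p n + s • u n) s) := by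
  obtain ⟨z, hz⟩ : ∃ z : X, ∀ U ∈ 𝓝 z, {B ∈ ballsOfRadiusGE 𝓑 ρ | (B ∩ U).Nonempty}.Infinite := by
    by_contra! hcon
    refine hnot fun z => ?_
    obtain ⟨U, hU, hfin⟩ := hcon z
    exact ⟨U, hU, (hfin.preimage Subtype.val_injective.injOn).subset fun B hB => ⟨B.2, hB⟩⟩
  obtain ⟨C, hC, hzC⟩ := hcov.symm.subset (mem_univ z)
  have hCfin := hstar.finite_inter_nonempty hC
  obtain ⟨c₀, r₀, hr₀, hCeq⟩ := hball C hC
  have hzc : ‖c₀ - z‖ ≤ r₀ := by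
    rw [hCeq, mem_closedBall', dist_eq_norm] at hzC
    exact hzC
  -- If z were interior to C, infinitely many members would meet C.
  have hzc' : r₀ ≤ ‖c₀ - z‖ := by
    by_contra! hlt
    have hnhds : C ∈ 𝓝 z := by
      rw [hCeq]
      exact closedBall_mem_nhds_of_mem (by rwa [mem_ball', dist_eq_norm])
    exact hz C hnhds (hCfin.subset fun B hB => ⟨hB.1.1, by rw [inter_comm]; exact hB.2⟩)
  obtain ⟨p₀, x, hx, hp₀, hx'⟩ := exists_closedBall_subset_of_le_norm hr₀ hzc'
  obtain rfl : p₀ = z := by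
    rw [← sub_eq_zero, ← norm_eq_zero, hp₀]
    linarith
  -- The natural number paired with each ball strictly increases along the sequence, which forces
  -- the distances to z to tend to 0.
  obtain ⟨F, hF, hFF⟩ := exists_seq_of_forall_finset_exists
    (fun a : ℕ × Set X => a.2 ∈ ballsOfRadiusGE 𝓑 ρ ∧ Disjoint C a.2 ∧
      (a.2 ∩ ball p₀ (1 / ((a.1 : ℝ) + 1))).Nonempty)
    (fun a b => a.1 < b.1 ∧ Disjoint a.2 b.2) (by
      intro s hs
      obtain ⟨N, hN⟩ := (s.image Prod.fst).exists_nat_subset_range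
      have hbad : (⋃ a ∈ (s : Set (ℕ × Set X)), {G ∈ 𝓑 | (a.2 ∩ G).Nonempty}).Finite :=
        s.finite_toSet.biUnion fun a ha => hstar.finite_inter_nonempty (hs a ha).1.1
      obtain ⟨B, ⟨hB, hne⟩, hBbad⟩ := ((hz (ball p₀ (1 / ((N : ℝ) + 1)))
        (ball_mem_nhds _ Nat.one_div_pos_of_nat)).sdiff (hbad.union hCfin)).nonempty
      refine ⟨(N, B), ⟨hB, ?_, hne⟩, fun a ha => ⟨?_, ?_⟩⟩
      · by_contra hdis
        exact hBbad (Or.inr ⟨hB.1, not_disjoint_iff_nonempty_inter.1 hdis⟩)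
      · exact Finset.mem_range.1 (hN (Finset.mem_image_of_mem _ ha))
      · by_contra hdis
        exact hBbad (Or.inl (mem_biUnion (Finset.mem_coe.2 ha)
          ⟨hB.1, not_disjoint_iff_nonempty_inter.1 hdis⟩)))
  have hmono : StrictMono fun n => (F n).1 := fun m n hmn => (hFF m n hmn).1
  have htouch : ∀ n : ℕ, ∃ p u : X, ‖p - p₀‖ ≤ 1 / ((n : ℝ) + 1) ∧ ‖u‖ = 1 ∧
      ∀ s, 0 ≤ s → s ≤ ρ → closedBall (p + s • u) s ⊆ (F n).2 := by
    intro n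
    obtain ⟨⟨-, c, r, hr, hBeq⟩, hdis, y, hyB, hy⟩ := hF n
    have hp₀B : p₀ ∉ (F n).2 := fun h => disjoint_left.1 hdis hzC h
    rw [hBeq, mem_closedBall', dist_eq_norm, not_le] at hp₀B
    obtain ⟨p, u, hu, hp, hsub⟩ := exists_closedBall_subset_of_le_norm (hρ.trans_le hr) hp₀B.le
    refine ⟨p, u, ?_, hu, fun s hs hsρ => hBeq ▸ hsub s hs (hsρ.trans hr)⟩
    have h1 : dist y c ≤ r := by rw [hBeq] at hyB; exact hyB
    have h2 : dist y p₀ < 1 / (((F n).1 : ℝ) + 1) := hy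
    have h3 : ‖c - p₀‖ ≤ dist y c + dist y p₀ := by
      rw [← dist_eq_norm, dist_comm y c]
      exact dist_triangle _ _ _
    have h4 : 1 / (((F n).1 : ℝ) + 1) ≤ 1 / ((n : ℝ) + 1) :=
      Nat.one_div_le_one_div (hmono.id_le n)
    linarith
  choose p u hp hu hsub using htouch
  refine ⟨min ρ r₀, p₀, x, p, u, lt_min hρ hr₀, ?_, hx, hu, ?_, ?_⟩
  · rw [tendsto_iff_norm_sub_tendsto_zero]
    exact squeeze_zero (fun n => norm_nonneg _) hp tendsto_one_div_add_atTop_nhds_zero_nat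
  · have hlt : ∀ n m, n < m → Disjoint (closedBall (p n + (min ρ r₀) • u n) (min ρ r₀))
        (closedBall (p m + (min ρ r₀) • u m) (min ρ r₀)) := fun n m hnm =>
      (hFF n m hnm).2.mono (hsub n _ (lt_min hρ hr₀).le (min_le_left _ _))
        (hsub m _ (lt_min hρ hr₀).le (min_le_left _ _))
    intro n m hnm
    rcases hnm.lt_or_gt with h | h
    exacts [hlt n m h, (hlt m n h).symm]
  · intro n s hs hsσ
    refine (hF n).2.1.mono ?_ (hsub n s hs (hsσ.trans (min_le_left _ _)))
    rw [hCeq]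
    exact hx' _ (lt_min hρ hr₀).le (min_le_right _ _)

/-- The directions of the touching balls of `exists_touching_sequence` are almost `2`-separated, and
almost opposite to `x` in the sense of the norm. -/
lemma exists_almost_two_separated {𝓑 : Set (Set X)} (hball : ConsistsOfClosedBalls 𝓑)
    (hcov : IsCovering 𝓑) (hstar : StarFinite 𝓑) {ρ : ℝ} (hρ : 0 < ρ)
    (hnot : ¬ LocallyFinite fun B : ballsOfRadiusGE 𝓑 ρ => (B : Set X)) :
    ∃ (x : X) (w : ℕ → X) (d : ℕ → ℝ), Tendsto d atTop (𝓝 0) ∧ ‖x‖ = 1 ∧ (∀ n, ‖w n‖ = 1) ∧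
      (∀ n m, n ≠ m → 2 - d n - d m ≤ ‖w n - w m‖) ∧
      ∀ n t, 0 ≤ t → t ≤ 1 → 1 + t - d n ≤ ‖x + t • w n‖ := by
  obtain ⟨σ, z, x, p, u, hσ, hp, hx, hu, huu, hxu⟩ :=
    exists_touching_sequence hball hcov hstar hρ hnot
  have hscale : ∀ (v a : X), ‖σ • v + a‖ ≤ σ * (‖v‖ + ‖a‖ / σ) := fun v a => by
    rw [mul_add, mul_div_cancel₀ _ hσ.ne']
    refine (norm_add_le _ _).trans_eq ?_
    rw [norm_smul, Real.norm_of_nonneg hσ.le]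
  refine ⟨x, fun n => -u n, fun n => ‖p n - z‖ / σ, ?_, hx, fun n => by rw [norm_neg, hu],
    fun n m hnm => ?_, fun n t ht ht1 => ?_⟩
  · simpa using (tendsto_iff_norm_sub_tendsto_zero.1 hp).div_const σ
  · have h := (disjoint_closedBall_closedBall_iff hσ.le hσ.le).1 (huu n m hnm)
    have heq : p n + σ • u n - (p m + σ • u m) =
        σ • (-(-u n - -u m)) + ((p n - z) - (p m - z)) := by
      rw [neg_sub_neg, neg_sub, smul_sub]; abel
    rw [dist_eq_norm, heq] at h
    have h2 := h.trans_le (hscale _ _)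
    rw [← two_mul, mul_comm, mul_lt_mul_iff_right₀ hσ, norm_neg] at h2
    have h3 : ‖(p n - z) - (p m - z)‖ / σ ≤ ‖p n - z‖ / σ + ‖p m - z‖ / σ := by
      rw [← add_div]
      gcongr
      exact norm_sub_le _ _
    linarith
  · have h := (disjoint_closedBall_closedBall_iff hσ.le (by positivity)).1
      (hxu n (σ * t) (by positivity) (mul_le_of_le_one_right hσ.le ht1))
    have heq : z + σ • x - (p n + (σ * t) • u n) = σ • (x + t • -u n) + -(p n - z) := by
      rw [smul_add, smul_smul, smul_neg]; abel
    rw [dist_eq_norm, heq] at h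
    have h2 := h.trans_le (hscale _ _)
    rw [show σ + σ * t = σ * (1 + t) by ring, mul_lt_mul_iff_right₀ hσ, norm_neg] at h2
    linarith

end Touching

/-! ### How each hypothesis excludes the accumulation. -/

section Obstructions

variable {X : Type*} [NormedAddCommGroup X]

lemma bddAbove_infsep_of_subset_sphere : BddAbove {s : ℝ | ∃ A : Set X, A ⊆ sphere (0 : X) 1 ∧
    A.Infinite ∧ A.Countable ∧ s = A.infsep} := by
  refine ⟨2, ?_⟩
  rintro s ⟨A, hA, hinf, -, rfl⟩
  obtain ⟨a, ha, b, hb, hab⟩ := hinf.nontrivial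
  refine (infsep_le_dist_of_mem ha hb hab).trans ?_
  have h1 : ‖a‖ = 1 := by simpa using hA ha
  have h2 : ‖b‖ = 1 := by simpa using hA hb
  rw [dist_eq_norm]
  linarith [norm_sub_le a b]

/-- An almost `2`-separated sequence does not eventually stay in a bounded set of diameter less
than `2`. -/
lemma false_of_eventually_mem_of_diam_lt {w : ℕ → X} {d : ℕ → ℝ} (hd : Tendsto d atTop (𝓝 0))
    (hww : ∀ n m, n ≠ m → 2 - d n - d m ≤ ‖w n - w m‖) {S : Set X} (hS : Bornology.IsBounded S)
    (hdiam : diam S < 2) (hmem : ∀ᶠ n in atTop, w n ∈ S) : False := by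
  obtain ⟨N, hN⟩ := eventually_atTop.1 (hmem.and (hd.eventually_lt_const
    (show 0 < (2 - diam S) / 2 by linarith)))
  have h := dist_le_diam_of_mem hS (hN N le_rfl).1 (hN (N + 1) (Nat.le_succ N)).1
  rw [dist_eq_norm] at h
  linarith [hww N (N + 1) N.lt_succ_self.ne, (hN N le_rfl).2, (hN (N + 1) (Nat.le_succ N)).2]

lemma false_of_tendsto_of_almost_two_separated {w : ℕ → X} {d : ℕ → ℝ}
    (hd : Tendsto d atTop (𝓝 0)) (hww : ∀ n m, n ≠ m → 2 - d n - d m ≤ ‖w n - w m‖) {x : X}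
    (hx : Tendsto w atTop (𝓝 x)) : False :=
  false_of_eventually_mem_of_diam_lt hd hww isBounded_closedBall
    ((diam_closedBall (x := x) (by norm_num : (0 : ℝ) ≤ 1 / 2)).trans_lt (by norm_num))
    (hx.eventually_mem (closedBall_mem_nhds x (by norm_num)))

lemma two_le_kottmanConstant {w : ℕ → X} {d : ℕ → ℝ} (hd : Tendsto d atTop (𝓝 0))
    (hw : ∀ n, ‖w n‖ = 1) (hww : ∀ n m, n ≠ m → 2 - d n - d m ≤ ‖w n - w m‖) :
    2 ≤ kottmanConstant X := by
  refine le_of_forall_pos_le_add fun η hη => ?_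
  -- The bound η / 2 gives separation 2 - η along the tail; the bound 1 / 2 keeps its terms
  -- distinct.
  obtain ⟨N, hN⟩ := eventually_atTop.1 (hd.eventually_lt_const
    (show 0 < min (η / 2) (1 / 2) by positivity))
  have hd' : ∀ n, d (n + N) < η / 2 ∧ d (n + N) < 1 / 2 := fun n =>
    ⟨(hN _ (Nat.le_add_left _ _)).trans_le (min_le_left _ _),
      (hN _ (Nat.le_add_left _ _)).trans_le (min_le_right _ _)⟩
  have hsep : ∀ n m, n ≠ m → 2 - d (n + N) - d (m + N) ≤ ‖w (n + N) - w (m + N)‖ :=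
    fun n m hnm => hww _ _ (by simpa using hnm)
  have hinj : Function.Injective fun n => w (n + N) := by
    intro n m hnm
    by_contra hne
    have h := hsep n m hne
    rw [show w (n + N) = w (m + N) from hnm, sub_self, norm_zero] at h
    linarith [(hd' n).2, (hd' m).2]
  have hinf : (range fun n => w (n + N)).Infinite := infinite_range_of_injective hinj
  have hle : 2 - η ≤ (range fun n => w (n + N)).infsep := by
    refine hinf.nontrivial.le_infsep ?_
    rintro _ ⟨n, rfl⟩ _ ⟨m, rfl⟩ hne
    rw [dist_eq_norm]
    have h := hsep n m fun h => hne (by rw [h])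
    linarith [(hd' n).1, (hd' m).1]
  have := le_csSup bddAbove_infsep_of_subset_sphere ⟨_, by
    rintro _ ⟨n, rfl⟩
    simpa using hw (n + N), hinf, countable_range _, rfl⟩ (a := (range fun n => w (n + N)).infsep)
  rw [kottmanConstant]
  linarith

variable [NormedSpace ℝ X]

/-- At a Fréchet smooth point the derivative of the norm is the only supporting functional. -/
lemma SupportsUnitBallAt.fderiv_norm {f : StrongDual ℝ X} {x : X} (hf : SupportsUnitBallAt f x)
    (hx : ‖x‖ = 1) (hs : IsFrechetSmoothPoint x) : fderiv ℝ (fun z : X => ‖z‖) x = f := by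
  -- This function is nonnegative and vanishes at x.
  have hmin : IsLocalMin (fun z : X => ‖z‖ - f z) x := Eventually.of_forall fun z => by
    have h1 : f z ≤ ‖z‖ := by
      have := f.le_opNorm z
      rw [hf.1, one_mul] at this
      exact (le_abs_self _).trans this
    simp only [hx, hf.2, sub_self]
    linarith
  have hder := hmin.fderiv_eq_zero
  rw [fderiv_fun_sub hs f.differentiableAt, f.fderiv, sub_eq_zero] at hder
  exact hder

/-- For a fixed small t, ‖x + t • w n‖ ≤ 1 + t f(w n) + tε/2 by differentiability. Against the lower
bound 1 + t - d n, this gives f(w n) > 1 - ε once d n < tε/2. -/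
lemma tendsto_of_isFrechetSmoothPoint {f : StrongDual ℝ X} {x : X} (hx : ‖x‖ = 1)
    (hf : SupportsUnitBallAt f x) (hs : IsFrechetSmoothPoint x) {w : ℕ → X} {d : ℕ → ℝ}
    (hd : Tendsto d atTop (𝓝 0)) (hw : ∀ n, ‖w n‖ = 1)
    (hxw : ∀ n t, 0 ≤ t → t ≤ 1 → 1 + t - d n ≤ ‖x + t • w n‖) :
    Tendsto (fun n => f (w n)) atTop (𝓝 1) := by
  have hle : ∀ n, f (w n) ≤ 1 := fun n => by
    have := f.le_opNorm (w n)
    rw [hf.1, hw, one_mul] at this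
    exact (le_abs_self _).trans this
  rw [Metric.tendsto_nhds]
  intro ε hε
  have hder := hs.hasFDerivAt
  rw [hf.fderiv_norm hx hs, hasFDerivAt_iff_isLittleO_nhds_zero, Asymptotics.isLittleO_iff] at hder
  obtain ⟨δ, hδ, hball⟩ := Metric.eventually_nhds_iff.1 (hder (half_pos hε))
  set t := min (δ / 2) 1 with ht
  have htpos : 0 < t := by positivity
  filter_upwards [hd.eventually_lt_const (show 0 < t * (ε / 2) by positivity)] with n hn
  have hnorm : ‖t • w n‖ = t := by rw [norm_smul, hw, mul_one, Real.norm_of_nonneg htpos.le]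
  have h1 := hball (y := t • w n) (by
    rw [dist_zero_right, hnorm]
    linarith [min_le_left (δ / 2) 1])
  rw [hnorm, hx, map_smul, smul_eq_mul] at h1
  have h2 := (le_abs_self _).trans h1
  have h3 := hxw n t htpos.le (min_le_right _ _)
  have h4 : t * (1 - ε) < t * f (w n) := by nlinarith
  have h5 := lt_of_mul_lt_mul_left h4 htpos.le
  rw [Real.dist_eq, abs_lt]
  constructor <;> linarith [hle n]

/-- No unit vector satisfying one of the four local conditions admits an almost `2`-separated
sequence of directions almost opposite to it. -/
lemma false_of_local_condition {x : X} (hx : ‖x‖ = 1) {w : ℕ → X} {d : ℕ → ℝ}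
    (hd : Tendsto d atTop (𝓝 0)) (hw : ∀ n, ‖w n‖ = 1)
    (hww : ∀ n m, n ≠ m → 2 - d n - d m ≤ ‖w n - w m‖)
    (hxw : ∀ n t, 0 ≤ t → t ≤ 1 → 1 + t - d n ≤ ‖x + t • w n‖)
    (hlocal : IsLURPoint x ∨ IsLND2Point x ∨ (IsFrechetSmoothPoint x ∧ IsStronglyExposedPoint x) ∨
      (IsFrechetSmoothPoint x ∧ HasSmallSupportingSlice x)) : False := by
  have hxw1 : ∀ n, 2 - d n ≤ ‖x + w n‖ := fun n => by
    have := hxw n 1 zero_le_one le_rfl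
    rw [one_smul] at this
    linarith
  rcases hlocal with hL | ⟨δ, hδ, hdiam⟩ | ⟨hs, f, hf, hexp⟩ | ⟨hs, f, hf, -, α, hα, hdiam⟩
  · refine false_of_tendsto_of_almost_two_separated hd hww (hL w hw ?_)
    refine tendsto_of_tendsto_of_tendsto_of_le_of_le (by simpa using tendsto_const_nhds.sub hd)
      tendsto_const_nhds hxw1 fun n => ?_
    have := norm_add_le x (w n)
    rw [hx, hw] at this
    linarith
  · refine false_of_eventually_mem_of_diam_lt hd hww
      (isBounded_sphere.subset fun y hy => hy.1) hdiam ?_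
    filter_upwards [hd.eventually_lt_const hδ] with n hn
    refine ⟨by simpa using hw n, ?_⟩
    rw [norm_smul, norm_inv, Real.norm_two]
    linarith [hxw1 n]
  · refine false_of_tendsto_of_almost_two_separated hd hww (hexp w (fun n => ?_) ?_)
    · simpa using (hw n).le
    · rw [hf.2]
      exact tendsto_of_isFrechetSmoothPoint hx hf hs hd hw hxw
  · refine false_of_eventually_mem_of_diam_lt hd hww
      (isBounded_closedBall.subset fun y hy => hy.1) hdiam ?_
    filter_upwards [(tendsto_of_isFrechetSmoothPoint hx hf hs hd hw hxw).eventually_const_lt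
      (sub_lt_self 1 hα)] with n hn
    exact ⟨by simpa using (hw n).le, hn⟩

/-- Among three norm-one functionals there are two that are large at a common vector of the unit
ball. -/
lemma exists_common_large_value {f : Fin 3 → StrongDual ℝ X} (hf : ∀ i, ‖f i‖ = 1) :
    ∃ i j, i ≠ j ∧ ∃ g : X, ‖g‖ ≤ 1 ∧ 1 / 7 + 1 / 100 ≤ f i g ∧ 1 / 7 + 1 / 100 ≤ f j g := by
  have hu : ∀ i, ∃ u : X, ‖u‖ ≤ 1 ∧ 1 - 1 / 100 ≤ f i u := by
    intro i
    obtain ⟨u, hu, hlt⟩ := (f i).exists_lt_apply_of_lt_opNorm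
      (show (1 - 1 / 100 : ℝ) < ‖f i‖ by rw [hf]; norm_num)
    rw [Real.norm_eq_abs] at hlt
    rcases le_total 0 (f i u) with h | h
    · exact ⟨u, hu.le, by rw [abs_of_nonneg h] at hlt; exact hlt.le⟩
    · exact ⟨-u, by rw [norm_neg]; exact hu.le, by
        rw [abs_of_nonpos h] at hlt; rw [map_neg]; exact hlt.le⟩
  choose u hu1 hu using hu
  by_contra! hcon
  have hsmall : ∀ i j, i ≠ j → f j (u i) < 1 / 7 + 1 / 100 := fun i j hij =>
    hcon i j hij (u i) (hu1 i) (by linarith [hu i])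
  have hneg : ∀ i j k, j ≠ k → f j (u i) ≤ -(1 / 7 + 1 / 100) → -(1 / 7 + 1 / 100) < f k (u i) := by
    intro i j k hjk h
    have := hcon j k hjk (-u i) (by rw [norm_neg]; exact hu1 i) (by rw [map_neg]; linarith)
    rw [map_neg] at this
    linarith
  have hhalf : ∀ a b : X, ‖a‖ ≤ 1 → ‖b‖ ≤ 1 → ‖(2⁻¹ : ℝ) • (a + b)‖ ≤ 1 := by
    intro a b ha hb
    rw [norm_smul, norm_inv, Real.norm_two]
    linarith [norm_add_le a b]
  -- Otherwise (u i + u j) / 2 has both values at least (0.99 - 0.6) / 2 > 1/7 + 1/100.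
  have hadd : ∀ i j, i ≠ j → f i (u j) < -(6 / 10) ∨ f j (u i) < -(6 / 10) := by
    intro i j hij
    by_contra! h
    have := hcon i j hij ((2⁻¹ : ℝ) • (u i + u j)) (hhalf _ _ (hu1 i) (hu1 j)) (by
      simp only [map_smul, map_add, smul_eq_mul]
      linarith [hu i, h.1])
    simp only [map_smul, map_add, smul_eq_mul] at this
    linarith [hu j, h.2]
  -- The vector (u k - u i) / 2 is large for both f j and f k.
  have hcyc : ∀ i j k, j ≠ k → i ≠ k → i ≠ j → f j (u i) < -(6 / 10) → f i (u k) < -(6 / 10) →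
      False := by
    intro i j k hjk hik hij h1 h2
    have h3 := hneg k i j hij (by linarith)
    have := hcon j k hjk ((2⁻¹ : ℝ) • (u k + -u i)) (hhalf _ _ (hu1 k)
      (by rw [norm_neg]; exact hu1 i)) (by
      simp only [map_smul, map_add, map_neg, smul_eq_mul]
      linarith)
    simp only [map_smul, map_add, map_neg, smul_eq_mul] at this
    linarith [hu k, hsmall i k hik]
  -- Draw an arrow i → j when f j (u i) < -0.6. Every pair is joined, `hneg` forbids two arrows out
  -- of one vertex, and `hcyc` excludes the remaining 3-cycles.
  have h01 := hadd 0 1 (by decide)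
  have h02 := hadd 0 2 (by decide)
  have h12 := hadd 1 2 (by decide)
  rcases h01 with h01 | h01 <;> rcases h02 with h02 | h02 <;> rcases h12 with h12 | h12 <;>
  first
  | exact absurd (hneg 0 1 2 (by decide) (by linarith)) (by linarith)
  | exact absurd (hneg 1 0 2 (by decide) (by linarith)) (by linarith)
  | exact absurd (hneg 2 0 1 (by decide) (by linarith)) (by linarith)
  | exact hcyc 0 1 2 (by decide) (by decide) (by decide) h01 h02
  | exact hcyc 0 2 1 (by decide) (by decide) (by decide) h02 h01

/-- With f the derivative at x, uniformity gives ‖x - v‖ ≤ 1 - f v + ‖v‖ / 7 for ‖v‖ ≤ δ, which is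
at most 1 on the cone. So every unit vector is δ-cone-smooth. -/
lemma IsUniformlyFrechetSmooth.hasDenseConeSmoothPoints [Nontrivial X]
    (h : IsUniformlyFrechetSmooth X) : HasDenseConeSmoothPoints X := by
  obtain ⟨hs, hunif⟩ := h
  obtain ⟨δ, hδ, hδ'⟩ := hunif (1 / 7) (by norm_num)
  refine ⟨δ, hδ, fun x hx => subset_closure ⟨hx, ?_⟩⟩
  have hx1 : ‖x‖ = 1 := by simpa using hx
  refine ⟨fderiv ℝ (fun z : X => ‖z‖) x, norm_fderiv_norm (hs x hx1), ?_⟩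
  rintro _ ⟨⟨v, hv, rfl⟩, hvδ⟩
  have hvn : ‖v‖ ≤ δ := by simpa [dist_eq_norm] using hvδ
  have h1 := (le_abs_self _).trans (hδ' x hx1 (-v) (by rwa [norm_neg]))
  have hv' : 1 / 7 * ‖v‖ ≤ fderiv ℝ (fun z : X => ‖z‖) x v := hv
  rw [map_neg, norm_neg, hx1, ← sub_eq_add_neg] at h1
  rw [mem_closedBall_zero_iff]
  show ‖x - v‖ ≤ 1
  linarith

/-- Three balls of the same radius that touch three points close to each other are not pairwise
disjoint, if the cone-smooth points are dense. -/
lemma HasDenseConeSmoothPoints.false_of_touching (h : HasDenseConeSmoothPoints X) {σ : ℝ}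
    (hσ : 0 < σ) {z : X} {p u : ℕ → X} (hp : Tendsto p atTop (𝓝 z)) (hu : ∀ n, ‖u n‖ = 1)
    (hdis : ∀ n m, n ≠ m →
      Disjoint (closedBall (p n + σ • u n) σ) (closedBall (p m + σ • u m) σ)) : False := by
  obtain ⟨ε, hε, hdense⟩ := h
  -- The perturbation e below has norm at most 2η. With η = τ / 1000 it fits in the slack 1/100
  -- above 1/7, and ‖τ • g + e‖ stays below ε = 2τ.
  set τ := ε / 2 with hτ
  have hτpos : 0 < τ := half_pos hε
  set η := τ / 1000 with hη
  have hηpos : 0 < η := by positivity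
  obtain ⟨N, hN⟩ := eventually_atTop.1 (hp.eventually (ball_mem_nhds z (mul_pos hσ hηpos)))
  have hcone : ∀ i : Fin 3, ∃ a : X, ‖a + u (N + i)‖ < η ∧ IsConeSmoothPoint ε a := by
    intro i
    obtain ⟨a, ⟨-, ha⟩, hdist⟩ := Metric.mem_closure_iff.1
      (hdense (show -u (N + i) ∈ sphere (0 : X) 1 by simpa using hu (N + i))) η hηpos
    refine ⟨a, ?_, ha⟩
    rwa [dist_comm, dist_eq_norm, sub_neg_eq_add] at hdist
  choose a ha f hf hsub using hcone
  obtain ⟨i, j, hij, g, hg, hgi, hgj⟩ := exists_common_large_value hf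
  -- The common point is z - (σ * τ) • g. Seen from the centre of ball k in units of σ, it is a k -
  -- (τ • g + e), which the cone at a k keeps in the unit ball.
  have hmem : ∀ k : Fin 3, 1 / 7 + 1 / 100 ≤ f k g →
      z - (σ * τ) • g ∈ closedBall (p (N + k) + σ • u (N + k)) σ := by
    intro k hk
    set e : X := σ⁻¹ • (p (N + k) - z) + (a k + u (N + k)) with he
    have he1 : ‖e‖ ≤ 2 * η := by
      have h1 : ‖p (N + k) - z‖ ≤ σ * η := by
        rw [← dist_eq_norm]
        exact (mem_ball.1 (hN _ (Nat.le_add_right _ _))).le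
      have h2 : ‖σ⁻¹ • (p (N + k) - z)‖ ≤ η := by
        rw [norm_smul, norm_inv, Real.norm_of_nonneg hσ.le, inv_mul_le_iff₀ hσ]
        exact h1
      linarith [norm_add_le (σ⁻¹ • (p (N + k) - z)) (a k + u (N + k)), ha k]
    have hτg : ‖τ • g‖ ≤ τ := by
      rw [norm_smul, Real.norm_of_nonneg hτpos.le]
      exact mul_le_of_le_one_right hτpos.le hg
    have hv1 : ‖τ • g + e‖ ≤ τ + 2 * η := (norm_add_le _ _).trans (add_le_add hτg he1)
    have hfe : -(2 * η) ≤ f k e := by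
      have := (f k).le_opNorm e
      rw [hf, one_mul] at this
      exact (neg_le_neg (this.trans he1)).trans (neg_abs_le _)
    have hball := hsub k (show a k - (τ • g + e) ∈ _ from ⟨⟨τ • g + e, by
      show 1 / 7 * ‖τ • g + e‖ ≤ f k (τ • g + e)
      rw [map_add, map_smul, smul_eq_mul]
      have := mul_le_mul_of_nonneg_left hk hτpos.le
      linarith, rfl⟩, by
      rw [mem_closedBall, dist_eq_norm, sub_sub_cancel_left, norm_neg]
      linarith⟩)
    rw [mem_closedBall_zero_iff] at hball
    have heq : z - (σ * τ) • g - (p (N + k) + σ • u (N + k)) = σ • (a k - (τ • g + e)) := by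
      rw [he, smul_sub, smul_add, smul_add, smul_add, smul_inv_smul₀ hσ.ne', smul_smul]
      abel
    rw [mem_closedBall, dist_eq_norm, heq, norm_smul, Real.norm_of_nonneg hσ.le]
    exact mul_le_of_le_one_right hσ.le hball
  exact disjoint_left.1 (hdis (N + i) (N + j) (by simpa [Fin.val_inj] using hij))
    (hmem i hgi) (hmem j hgj)

end Obstructions

/-! ### Assembly of the theorem. -/

/-- A space in which the large members of each star-finite covering by closed balls are locally
finite admits no such covering. -/
lemma not_admitsStarFiniteBallCovering {X : Type*} [NormedAddCommGroup X] [NormedSpace ℝ X]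
    [CompleteSpace X] (hX : ¬ FiniteDimensional ℝ X)
    (hloc : ∀ 𝓑 : Set (Set X), ConsistsOfClosedBalls 𝓑 → IsCovering 𝓑 → StarFinite 𝓑 →
      ∀ ρ : ℝ, 0 < ρ → LocallyFinite fun B : ballsOfRadiusGE 𝓑 ρ => (B : Set X)) :
    ¬ AdmitsStarFiniteBallCovering X := by
  rintro ⟨𝓑, hball, hcov, hstar⟩
  obtain ⟨𝓒, hsub, hcov', hmin⟩ := hstar.exists_minimal_subcovering hcov
  have hball' : ConsistsOfClosedBalls 𝓒 := fun B hB => hball B (hsub hB)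
  exact not_isCovering_of_locallyFinite hX hball' (hstar.mono hsub) hmin
    (hloc 𝓒 hball' hcov' (hstar.mono hsub)) hcov'

end BallCoverings

theorem mainTheorem1 (X : Type*) [NormedAddCommGroup X] [NormedSpace ℝ X] [CompleteSpace X]
    (hX : ¬ FiniteDimensional ℝ X) :
    ((BallCoverings.IsUniformlyFrechetSmooth X ∨
      BallCoverings.HasDenseConeSmoothPoints X ∨
      BallCoverings.kottmanConstant X < 2 ∨
      (∀ x : X, ‖x‖ = 1 →
        BallCoverings.IsLURPoint x ∨
        BallCoverings.IsLND2Point x ∨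
        (BallCoverings.IsFrechetSmoothPoint x ∧ BallCoverings.IsStronglyExposedPoint x) ∨
        (BallCoverings.IsFrechetSmoothPoint x ∧ BallCoverings.HasSmallSupportingSlice x))) →
      ¬ BallCoverings.AdmitsStarFiniteBallCovering X) ∧
    (BallCoverings.IsLURSpace X ∨ BallCoverings.IsUniformlyFrechetSmooth X →
      ¬ BallCoverings.AdmitsStarFiniteBallCovering X) := by
  have hnt : Nontrivial X := by
    by_contra hnt
    rw [not_nontrivial_iff_subsingleton] at hnt
    exact hX inferInstance
  -- The second conjunct is a special case of the first.
  rw [and_iff_left_of_imp fun h h' => h (h'.elim (fun hL => Or.inr (Or.inr (Or.inr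
    fun x hx => Or.inl (hL x hx)))) Or.inl)]
  intro h
  refine BallCoverings.not_admitsStarFiniteBallCovering hX fun 𝓑 hball hcov hstar ρ hρ => ?_
  by_contra hnot
  obtain ⟨σ, z, x, p, u, hσ, hp, -, hu, huu, -⟩ :=
    BallCoverings.exists_touching_sequence hball hcov hstar hρ hnot
  obtain ⟨y, w, d, hd, hy, hw, hww, hyw⟩ :=
    BallCoverings.exists_almost_two_separated hball hcov hstar hρ hnot
  rcases h with h | h | h | h
  · exact h.hasDenseConeSmoothPoints.false_of_touching hσ hp hu huu
  · exact h.false_of_touching hσ hp hu huu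
  · exact h.not_ge (BallCoverings.two_le_kottmanConstant hd hw hww)
  · exact BallCoverings.false_of_local_condition hy hd hw hww hyw (h y hy)
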